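/- Let $d$ be a dimension and let $\mathcal S\subseteq\{-1,0,1\}^d\setminus\{\mathbf 0\}$ be a highly symmetric step set, that is: for every $k$, $(i_1,\dots,i_k,\dots,i_d)\in\mathcal S$ implies $(i_1,\dots,-i_k,\dots,i_d)\in\mathcal S$, and for every $k$ some step of $\mathcal S$ has positive $k$-th coordinate. For $\mathbf i\in\mathbb Z^d$ and $n\ge 0$ let $s_{\mathbf i}(n)$ be the number of walks of length $n$ with steps in $\mathcal S$ that start at the origin, never leave $\mathbb N^d=\mathbb Z_{\ge 0}^d$, and end at $\mathbf i$. Put $$F(\mathbf z,t)=\sum_{n\ge 0}\Big(\sum_{\mathbf i\in\mathbb Z^d}s_{\mathbf i}(n)\,z_1^{i_1}\cdots z_d^{i_d}\Big)t^n,\qquad F(\mathbf 1,t)=\sum_{n\ge 0}\Big(\sum_{\mathbf i\in\mathbb Z^d}s_{\mathbf i}(n)\Big)t^n .$$ Since $s_{\mathbf i}(n)=0$ unless $\mathbf i\in\mathbb N^d$, $F(\mathbf z,t)$ is a formal power series over $\mathbb Q$ in $z_1,\dots,z_d,t$. A formal power series over a field $K$ in finitely many variables is called D-finite if, for each of its variables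 $x$, it satisfies a nontrivial linear differential equation $\sum_{k=0}^N p_k\,\partial^k f/\partial x^k=0$ in which the $p_k$ are polynomials over $K$ in all the variables, not all zero. Then $F(\mathbf z,t)$, as a power series over $\mathbb Q$ in $z_1,\dots,z_d,t$, and $F(\mathbf 1,t)$, as a power series over $\mathbb Q$ in $t$, are both D-finite. -/

import Mathlib

/-- A step set `S ⊆ {-1,0,1}^d \ {0}` is highly symmetric if it is invariant under changing the
sign of any single coordinate and, for every coordinate, contains a step that moves in the
positive direction of that coordinate. -/
structure IsHighlySymmetric {d : ℕ} (S : Finset (Fin d → ℤ)) : Prop where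
  unit_steps : ∀ s ∈ S, ∀ k, s k = -1 ∨ s k = 0 ∨ s k = 1
  zero_notMem : (0 : Fin d → ℤ) ∉ S
  symmetric : ∀ s ∈ S, ∀ k, Function.update s k (-(s k)) ∈ S
  exists_pos : ∀ k, ∃ s ∈ S, 0 < s k

/-- The position after the first `m` steps of the walk with step sequence `w`, started at the
origin. -/
def walkPosition {d n : ℕ} (w : Fin n → Fin d → ℤ) (m : ℕ) : Fin d → ℤ :=
  ∑ j ∈ Finset.univ.filter (fun j : Fin n => (j : ℕ) < m), w j

/-- The walks of length `n` (as sequences of steps from `S`) that start at the origin and stay in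
the orthant `ℕ^d`. -/
def orthantWalks {d : ℕ} (S : Finset (Fin d → ℤ)) (n : ℕ) : Finset (Fin n → Fin d → ℤ) :=
  {w ∈ Fintype.piFinset (fun _ : Fin n => S) | ∀ m ≤ n, ∀ k, 0 ≤ walkPosition w m k}

/-- The number of walks of length `n` with steps from `S` that start at the origin, stay in the
orthant `ℕ^d` and end at the lattice point `i`. -/
def walkCount {d : ℕ} (S : Finset (Fin d → ℤ)) (i : Fin d → ℤ) (n : ℕ) : ℕ :=
  ((orthantWalks S n).filter (fun w => walkPosition w n = i)).card

/-- The generating function `F(z, t)`, the sum over `i` and `n` of `walkCount S i n * z ^ i * t ^ n`.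
The variable `some k` is the coordinate variable `z_k`, and the variable `none` is the length
variable `t`. Only exponents `i ∈ ℕ^d` are needed, since `walkCount S i n = 0` for all other
`i ∈ ℤ^d` (`walkCount_eq_zero`). -/
def walkGF {d : ℕ} (S : Finset (Fin d → ℤ)) : MvPowerSeries (Option (Fin d)) ℚ :=
  fun e => (walkCount S (fun k => (e (some k) : ℤ)) (e none) : ℚ)

/-- The specialization `G(1, …, 1, t)` of a power series `G(z, t)` at `z = (1, …, 1)`: the
coefficient of `t ^ n` is the sum of the coefficients of all `z ^ a * t ^ n`. It is meaningful for
series with finitely many nonzero terms for every `n`, such as `walkGF S`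
(`walkGF_finite_support`). -/
noncomputable def specializeOne {d : ℕ} (G : MvPowerSeries (Option (Fin d)) ℚ) : PowerSeries ℚ :=
  PowerSeries.mk fun n => ∑ᶠ a : Fin d →₀ ℕ, MvPowerSeries.coeff (a.optionElim n) G

/-- A formal power series `f` over a field `K`, in finitely many variables indexed by `σ`, is
D-finite if, for every variable `x_i`, it satisfies a nontrivial linear differential equation
`p_0 f + p_1 ∂f/∂x_i + ⋯ + p_N ∂^N f/∂x_i^N = 0` whose coefficients `p_k` are polynomials in all
the variables. For a univariate series (`PowerSeries K = MvPowerSeries Unit K`) this is a single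
linear ordinary differential equation with polynomial coefficients. -/
def IsDFinite {σ : Type*} [Finite σ] {K : Type*} [Field K] (f : MvPowerSeries σ K) : Prop :=
  ∀ i : σ, ∃ (N : ℕ) (p : Fin (N + 1) → MvPolynomial σ K), p ≠ 0 ∧
    ∑ k : Fin (N + 1),
      (p k : MvPowerSeries σ K) * (⇑(MvPowerSeries.pderiv K i))^[(k : ℕ)] f = 0

theorem walkCount_eq_zero {d : ℕ} (S : Finset (Fin d → ℤ)) (i : Fin d → ℤ) (n : ℕ)
    (hi : ∃ k, i k < 0) : walkCount S i n = 0 := by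
  obtain ⟨k, hk⟩ := hi
  rw [walkCount, Finset.card_eq_zero, Finset.filter_eq_empty_iff]
  intro w hw h
  have := (Finset.mem_filter.1 hw).2 n le_rfl k
  rw [h] at this
  omega

theorem coeff_walkGF {d : ℕ} (S : Finset (Fin d → ℤ)) (a : Fin d →₀ ℕ) (n : ℕ) :
    MvPowerSeries.coeff (a.optionElim n) (walkGF S) = walkCount S (fun k => (a k : ℤ)) n := by
  show ((walkCount S (fun k => ((a.optionElim n (some k) : ℕ) : ℤ)) (a.optionElim n none) : ℕ) : ℚ)
    = _
  simp only [Finsupp.optionElim_apply_some, Finsupp.optionElim_apply_none]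

theorem walkGF_finite_support {d : ℕ} (S : Finset (Fin d → ℤ)) (n : ℕ) :
    (Function.support fun a : Fin d →₀ ℕ =>
      MvPowerSeries.coeff (a.optionElim n) (walkGF S)).Finite := by
  have hinj : Function.Injective (fun (a : Fin d →₀ ℕ) (k : Fin d) => (a k : ℤ)) := by
    intro a b h
    ext k
    exact Int.ofNat_inj.1 (congrFun h k)
  refine (((orthantWalks S n).image fun w => walkPosition w n).finite_toSet.preimage
    hinj.injOn).subset ?_
  intro a ha
  rw [Function.mem_support, coeff_walkGF, Nat.cast_ne_zero, walkCount, Finset.card_ne_zero] at ha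
  obtain ⟨w, hw⟩ := ha
  rw [Finset.mem_filter] at hw
  simp only [Set.mem_preimage, Finset.mem_coe, Finset.mem_image]
  exact ⟨w, hw⟩

/-- `F(1, t)` is the generating function of the total numbers of walks in the orthant. -/
theorem coeff_specializeOne_walkGF {d : ℕ} (S : Finset (Fin d → ℤ)) (n : ℕ) :
    PowerSeries.coeff n (specializeOne (walkGF S)) = (orthantWalks S n).card := by
  have hfin := walkGF_finite_support S n
  rw [specializeOne, PowerSeries.coeff_mk, finsum_eq_sum _ hfin,
    Finset.sum_congr rfl fun a _ => coeff_walkGF S a n]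
  rw [← Nat.cast_sum]
  congr 1
  symm
  have key : ∀ w ∈ orthantWalks S n,
      (fun k => ((Finsupp.equivFunOnFinite.symm fun k => (walkPosition w n k).toNat) k : ℤ))
        = walkPosition w n := by
    intro w hw
    funext k
    simpa using (Finset.mem_filter.1 hw).2 n le_rfl k
  rw [Finset.card_eq_sum_card_fiberwise
    (f := fun w => Finsupp.equivFunOnFinite.symm fun k => (walkPosition w n k).toNat)
    (t := hfin.toFinset)]
  · refine Finset.sum_congr rfl fun a _ => ?_
    rw [walkCount]
    congr 1
    refine Finset.filter_congr fun w hw => ?_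
    constructor
    · rintro rfl
      exact (key w hw).symm
    · intro h
      ext k
      simp [h]
  · intro w hw
    have hw' : w ∈ orthantWalks S n := hw
    simp only [Set.Finite.coe_toFinset, Function.mem_support, coeff_walkGF, key w hw',
      Nat.cast_ne_zero, walkCount, Finset.card_ne_zero]
    exact ⟨w, Finset.mem_filter.2 ⟨hw', rfl⟩⟩

/-! The reflection principle turns walk counts into constant terms. Let S(z) be the sum of z^s over
the steps. For i in the orthant, the number of walks of length n from 0 to i is the coefficient of
z^i in ∏ (1 - z_k⁻²) S(z)^n: both sides have the same initial values and recursion, and the right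
side is antisymmetric about each hyperplane i_k = -1, so it vanishes there
(`walkCount_eq_signedCount`). Summation over i ≥ 0 telescopes and replaces the prefactor by ∏ (1 +
z_k⁻¹) (`pairing_reflectionPoly_mul`). Hence both series are constant terms in z of fractions c(z) /
∏ (1 - a_i(z) X_i), where the X_i are the variables of the resulting series.

Such constant terms are D-finite by a dimension count (`isDFinite_laurentCoeff_zero`). Let f be the
fraction, x one of the X_i, and L_k = z_k ∂/∂z_k ∘ z_k⁻¹. The elements X^α ∂_x^c L^γ f with all
indices at most N number (N+1)^(|σ|+1+|τ|), but lie in a space of dimension O(N^(|σ|+|τ|)), so for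
suitable N they are linearly dependent over ℚ (`exists_linear_relation`). The coefficient of z^m in
L^γ f is that of z^(m+γ) in f times ∏ m_k(m_k+1)⋯(m_k+γ_k-1). Choose γ₀ minimal among the γ that
occur and extract the coefficient of z^(-γ₀): all other γ drop out, leaving a nontrivial
differential equation in x for the constant term. -/

/-- Laurent polynomials over `ℚ` in the variables indexed by `τ`. -/
abbrev LaurentPoly (τ : Type*) := AddMonoidAlgebra ℚ (τ → ℤ)

/-! ### Euler operators and coefficient extraction in z -/

section Euler

variable {σ τ : Type*}

/-- The Euler operator `z_k ∂/∂z_k`, which multiplies the coefficient of `z ^ m` by `m k`, as a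
derivation. -/
noncomputable def eulerDerivation (k : τ) : Derivation ℚ (LaurentPoly τ) (LaurentPoly τ) :=
  Derivation.mk'
    { toFun := fun x => x.coeff.sum fun m r => AddMonoidAlgebra.single m ((m k : ℚ) * r)
      map_add' := fun x y => by
        rw [AddMonoidAlgebra.coeff_add, Finsupp.sum_add_index'] <;> intros <;>
          simp [mul_add, AddMonoidAlgebra.single_add]
      map_smul' := fun r x => by
        rw [AddMonoidAlgebra.coeff_smul, Finsupp.sum_smul_index'] <;> intros <;>
          simp [Finsupp.smul_sum, mul_left_comm] }
    (by
      intro x y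
      induction x using AddMonoidAlgebra.induction_linear with
      | zero => simp
      | add x₁ x₂ h₁ h₂ => simp only [add_mul, map_add, h₁, h₂, smul_eq_mul, mul_add]; ring
      | single m r =>
        induction y using AddMonoidAlgebra.induction_linear with
        | zero => simp
        | add x₁ x₂ h₁ h₂ => simp only [add_mul, map_add, h₁, h₂, smul_eq_mul, mul_add]; ring
        | single m' r' =>
          simp only [LinearMap.coe_mk, AddHom.coe_mk, AddMonoidAlgebra.single_mul_single,
            smul_eq_mul, AddMonoidAlgebra.coeff_single, Finsupp.sum_single_index, mul_zero,
            AddMonoidAlgebra.single_zero]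
          rw [add_comm m' m, ← AddMonoidAlgebra.single_add]
          congr 1
          push_cast [Pi.add_apply]
          ring)

theorem eulerDerivation_single (k : τ) (m : τ → ℤ) (r : ℚ) :
    eulerDerivation k (AddMonoidAlgebra.single m r) = AddMonoidAlgebra.single m ((m k : ℚ) * r) := by
  simp [eulerDerivation]

theorem coeff_eulerDerivation (k : τ) (x : LaurentPoly τ) (m : τ → ℤ) :
    (eulerDerivation k x).coeff m = (m k : ℚ) * x.coeff m := by
  classical
  induction x using AddMonoidAlgebra.induction_linear with
  | zero => simp
  | add x₁ x₂ h₁ h₂ => simp [h₁, h₂, mul_add]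
  | single m' r =>
    simp only [eulerDerivation_single, AddMonoidAlgebra.coeff_single, Finsupp.single_apply]
    split_ifs with h
    · rw [h]
    · simp

/-- A linear map applied to every coefficient of a power series. -/
def MvPowerSeries.mapCoeff (σ : Type*) {K R S : Type*} [CommRing K] [CommRing R] [CommRing S]
    [Algebra K R] [Algebra K S] (φ : R →ₗ[K] S) : MvPowerSeries σ R →ₗ[K] MvPowerSeries σ S where
  toFun f e := φ (MvPowerSeries.coeff e f)
  map_add' f g := funext fun e => map_add φ (f e) (g e)
  map_smul' r f := funext fun e => map_smul φ r (f e)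

theorem MvPowerSeries.coeff_mapCoeff {K R S : Type*} [CommRing K] [CommRing R] [CommRing S]
    [Algebra K R] [Algebra K S] (φ : R →ₗ[K] S) (f : MvPowerSeries σ R) (e : σ →₀ ℕ) :
    MvPowerSeries.coeff e (MvPowerSeries.mapCoeff σ φ f) = φ (MvPowerSeries.coeff e f) :=
  rfl

/-- A derivation of the coefficient ring, applied to every coefficient of a power series. -/
noncomputable def MvPowerSeries.mapDerivation (σ : Type*) {K R : Type*} [CommRing K] [CommRing R]
    [Algebra K R] (D : Derivation K R R) :
    Derivation K (MvPowerSeries σ R) (MvPowerSeries σ R) :=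
  Derivation.mk' (MvPowerSeries.mapCoeff σ (D : R →ₗ[K] R))
    (by
      classical
      intro f g
      ext e
      simp only [smul_eq_mul, map_add]
      rw [mul_comm g, MvPowerSeries.coeff_mapCoeff, MvPowerSeries.coeff_mul,
        MvPowerSeries.coeff_mul, MvPowerSeries.coeff_mul, map_sum, ← Finset.sum_add_distrib]
      refine Finset.sum_congr rfl fun p _ => ?_
      rw [MvPowerSeries.coeff_mapCoeff, MvPowerSeries.coeff_mapCoeff,
        Derivation.coeFn_coe, Derivation.leibniz, smul_eq_mul, smul_eq_mul,
        mul_comm (MvPowerSeries.coeff p.2 g)])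

theorem MvPowerSeries.coeff_mapDerivation {K R : Type*} [CommRing K] [CommRing R] [Algebra K R]
    (D : Derivation K R R) (f : MvPowerSeries σ R) (e : σ →₀ ℕ) :
    MvPowerSeries.coeff e (MvPowerSeries.mapDerivation σ D f) = D (MvPowerSeries.coeff e f) :=
  rfl

/-- The coefficient of `z ^ m` in a power series over the Laurent polynomials in `z`. -/
noncomputable def laurentCoeff (σ : Type*) (m : τ → ℤ) :
    MvPowerSeries σ (LaurentPoly τ) →ₗ[ℚ] MvPowerSeries σ ℚ :=
  MvPowerSeries.mapCoeff σ
    { toFun := fun x => x.coeff m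
      map_add' := fun _ _ => rfl
      map_smul' := fun _ _ => rfl }

theorem coeff_laurentCoeff (m : τ → ℤ) (f : MvPowerSeries σ (LaurentPoly τ)) (e : σ →₀ ℕ) :
    MvPowerSeries.coeff e (laurentCoeff σ m f) = (MvPowerSeries.coeff e f).coeff m :=
  rfl

theorem laurentCoeff_monomial_mul (m : τ → ℤ) (a : σ →₀ ℕ) (f : MvPowerSeries σ (LaurentPoly τ)) :
    laurentCoeff σ m (MvPowerSeries.monomial a 1 * f) =
      MvPowerSeries.monomial a 1 * laurentCoeff σ m f := by
  classical
  ext e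
  rw [coeff_laurentCoeff, MvPowerSeries.coeff_monomial_mul, MvPowerSeries.coeff_monomial_mul]
  split_ifs <;> simp [coeff_laurentCoeff]

theorem laurentCoeff_pderiv (m : τ → ℤ) (v : σ) (f : MvPowerSeries σ (LaurentPoly τ)) :
    laurentCoeff σ m (MvPowerSeries.pderiv _ v f) =
      MvPowerSeries.pderiv ℚ v (laurentCoeff σ m f) := by
  ext e
  rw [coeff_laurentCoeff, MvPowerSeries.coeff_pderiv, MvPowerSeries.coeff_pderiv,
    coeff_laurentCoeff]
  rw [← Nat.cast_add_one, ← Nat.cast_add_one, ← nsmul_eq_mul', ← nsmul_eq_mul',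
    ← AddMonoidAlgebra.coeff_smul_apply]

theorem laurentCoeff_iterate_pderiv (m : τ → ℤ) (v : σ) (n : ℕ)
    (f : MvPowerSeries σ (LaurentPoly τ)) :
    laurentCoeff σ m ((⇑(MvPowerSeries.pderiv (LaurentPoly τ) v))^[n] f) =
      (⇑(MvPowerSeries.pderiv ℚ v))^[n] (laurentCoeff σ m f) :=
  Function.Semiconj.iterate_right (f := laurentCoeff σ m)
    (fun f => laurentCoeff_pderiv m v f) n f

/-- The operator `g ↦ z_k⁻¹ (z_k ∂g/∂z_k - g)`, which is `z_k ∂/∂z_k ∘ z_k⁻¹`. -/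
noncomputable def lowerOp [DecidableEq τ] (k : τ) (g : MvPowerSeries σ (LaurentPoly τ)) :
    MvPowerSeries σ (LaurentPoly τ) :=
  MvPowerSeries.C (AddMonoidAlgebra.single (-Pi.single k 1) 1) *
    (MvPowerSeries.mapDerivation σ (eulerDerivation k) g - g)

/-- The factor `m k` is the reason for using this operator instead of ∂/∂z_k, whose factor would be
`m k + 1`. That would single out the residue, the coefficient of z_k⁻¹, where the constant term is
wanted. -/
theorem laurentCoeff_lowerOp [DecidableEq τ] (k : τ) (g : MvPowerSeries σ (LaurentPoly τ))
    (m : τ → ℤ) :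
    laurentCoeff σ m (lowerOp k g) = (m k : ℚ) • laurentCoeff σ (m + Pi.single k 1) g := by
  ext e
  rw [coeff_laurentCoeff, lowerOp, MvPowerSeries.coeff_C_mul,
    AddMonoidAlgebra.coeff_single_mul_apply, map_sub, MvPowerSeries.coeff_mapDerivation]
  rw [AddMonoidAlgebra.coeff_sub, Finsupp.sub_apply, coeff_eulerDerivation, map_smul,
    coeff_laurentCoeff]
  simp [add_comm]
  ring

end Euler

/-! ### Polynomials of bounded degree in X and z -/

section Box

open MvPowerSeries

variable {σ τ : Type*}

/-- The span of the monomials `X ^ e * z ^ m` all of whose exponents are at most `D` in absolute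
value. -/
noncomputable def boxSpan (σ τ : Type*) (D : ℕ) : Submodule ℚ (MvPowerSeries σ (LaurentPoly τ)) :=
  Submodule.span ℚ {g | ∃ (e : σ →₀ ℕ) (m : τ → ℤ), (∀ i, e i ≤ D) ∧ (∀ k, |m k| ≤ D) ∧
    g = monomial e (AddMonoidAlgebra.single m 1)}

theorem monomial_mem_boxSpan {D : ℕ} {e : σ →₀ ℕ} {m : τ → ℤ} (he : ∀ i, e i ≤ D)
    (hm : ∀ k, |m k| ≤ D) (r : ℚ) :
    monomial e (AddMonoidAlgebra.single m r) ∈ boxSpan σ τ D := by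
  have : (monomial e (AddMonoidAlgebra.single m r) : MvPowerSeries σ (LaurentPoly τ)) =
      r • monomial e (AddMonoidAlgebra.single m 1) := by
    rw [← LinearMap.map_smul_of_tower, AddMonoidAlgebra.smul_single, smul_eq_mul, mul_one]
  rw [this]
  exact Submodule.smul_mem _ _ (Submodule.subset_span ⟨e, m, he, hm, rfl⟩)

theorem boxSpan_mono : Monotone (boxSpan σ τ) := by
  intro D E h
  refine Submodule.span_mono ?_
  rintro _ ⟨e, m, he, hm, rfl⟩
  exact ⟨e, m, fun i => (he i).trans h, fun k => (hm k).trans (by exact_mod_cast h), rfl⟩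

theorem mul_mem_boxSpan {D E : ℕ} {f g : MvPowerSeries σ (LaurentPoly τ)}
    (hf : f ∈ boxSpan σ τ D) (hg : g ∈ boxSpan σ τ E) : f * g ∈ boxSpan σ τ (D + E) := by
  have h : boxSpan σ τ D * boxSpan σ τ E ≤ boxSpan σ τ (D + E) := by
    rw [boxSpan, boxSpan, Submodule.span_mul_span, Submodule.span_le]
    rintro _ ⟨_, ⟨e, m, he, hm, rfl⟩, _, ⟨e', m', he', hm', rfl⟩, rfl⟩
    simp only [monomial_mul_monomial, AddMonoidAlgebra.single_mul_single, SetLike.mem_coe]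
    refine monomial_mem_boxSpan (fun i => ?_) (fun k => ?_) _
    · exact add_le_add (he i) (he' i)
    · exact (abs_add_le _ _).trans (by push_cast; exact add_le_add (hm k) (hm' k))
  exact h (Submodule.mul_mem_mul hf hg)

theorem one_mem_boxSpan : (1 : MvPowerSeries σ (LaurentPoly τ)) ∈ boxSpan σ τ 0 :=
  monomial_mem_boxSpan (e := 0) (m := 0) (by simp) (by simp) 1

theorem X_mem_boxSpan (i : σ) : (X i : MvPowerSeries σ (LaurentPoly τ)) ∈ boxSpan σ τ 1 := by
  classical
  refine monomial_mem_boxSpan (m := 0) (fun j => ?_) (by simp) 1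
  rw [Finsupp.single_apply]
  split_ifs <;> simp

theorem C_single_mem_boxSpan [DecidableEq τ] (k : τ) :
    (C (AddMonoidAlgebra.single (-Pi.single k 1) 1) : MvPowerSeries σ (LaurentPoly τ)) ∈
      boxSpan σ τ 1 := by
  refine monomial_mem_boxSpan (e := 0) (by simp) (fun j => ?_) 1
  rw [Pi.neg_apply, Pi.single_apply]
  split_ifs <;> simp

theorem exists_C_mem_boxSpan [Finite τ] (x : LaurentPoly τ) :
    ∃ D, (C x : MvPowerSeries σ (LaurentPoly τ)) ∈ boxSpan σ τ D := by
  have := Fintype.ofFinite τ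
  induction x using AddMonoidAlgebra.induction_linear with
  | zero => exact ⟨0, by simp⟩
  | add x y hx hy =>
    obtain ⟨D, hD⟩ := hx
    obtain ⟨E, hE⟩ := hy
    refine ⟨max D E, ?_⟩
    rw [map_add]
    exact add_mem (boxSpan_mono (le_max_left _ _) hD) (boxSpan_mono (le_max_right _ _) hE)
  | single m r =>
    refine ⟨∑ k, (m k).natAbs, monomial_mem_boxSpan (e := 0) (by simp) (fun k => ?_) r⟩
    rw [Int.abs_eq_natAbs]
    exact_mod_cast Finset.single_le_sum (f := fun k => (m k).natAbs) (fun _ _ => Nat.zero_le _)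
      (Finset.mem_univ k)

theorem exists_prod_mem_boxSpan {ι : Type*} (s : Finset ι)
    (f : ι → MvPowerSeries σ (LaurentPoly τ)) (hf : ∀ i ∈ s, ∃ D, f i ∈ boxSpan σ τ D) :
    ∃ D, ∏ i ∈ s, f i ∈ boxSpan σ τ D := by
  classical
  induction s using Finset.induction_on with
  | empty => exact ⟨0, one_mem_boxSpan⟩
  | insert a s ha ih =>
    obtain ⟨D, hD⟩ := hf a (Finset.mem_insert_self _ _)
    obtain ⟨E, hE⟩ := ih fun i hi => hf i (Finset.mem_insert_of_mem hi)
    exact ⟨D + E, by rw [Finset.prod_insert ha]; exact mul_mem_boxSpan hD hE⟩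

theorem mapDerivation_eulerDerivation_mem_boxSpan (k : τ) {D : ℕ}
    {f : MvPowerSeries σ (LaurentPoly τ)} (hf : f ∈ boxSpan σ τ D) :
    mapDerivation σ (eulerDerivation k) f ∈ boxSpan σ τ D := by
  classical
  induction hf using Submodule.span_induction with
  | zero => simp
  | add f g _ _ hf hg => rw [map_add]; exact add_mem hf hg
  | smul r f _ hf => rw [Derivation.map_smul]; exact Submodule.smul_mem _ _ hf
  | mem f hf =>
    obtain ⟨e, m, he, hm, rfl⟩ := hf
    convert monomial_mem_boxSpan he hm ((m k : ℚ) * 1)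
    ext1 n
    rw [coeff_mapDerivation, coeff_monomial, coeff_monomial]
    split_ifs
    · exact eulerDerivation_single k m 1
    · exact map_zero _

theorem pderiv_mem_boxSpan (v : σ) {D : ℕ}
    {f : MvPowerSeries σ (LaurentPoly τ)} (hf : f ∈ boxSpan σ τ D) :
    pderiv _ v f ∈ boxSpan σ τ D := by
  classical
  induction hf using Submodule.span_induction with
  | zero => simp
  | add f g _ _ hf hg => rw [map_add]; exact add_mem hf hg
  | smul r f _ hf =>
    rw [Derivation.map_smul_of_tower]
    exact Submodule.smul_mem _ _ hf
  | mem f hf =>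
    obtain ⟨e, m, he, hm, rfl⟩ := hf
    -- If `e v = 0`, the truncated exponent `e - single v 1` is meaningless, but the coefficient `e
    -- v` is then zero.
    convert monomial_mem_boxSpan (D := D) (e := e - Finsupp.single v 1)
      (fun i => (Nat.sub_le _ _).trans (he i)) hm (e v : ℚ)
    ext1 n
    rw [coeff_pderiv, coeff_monomial, coeff_monomial]
    by_cases h : n + Finsupp.single v 1 = e
    · subst h
      rw [if_pos rfl, if_pos (by simp), ← Nat.cast_add_one, ← nsmul_eq_mul',
        AddMonoidAlgebra.smul_single]
      simp
    · rw [if_neg h, zero_mul]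
      split_ifs with h'
      · have hv : e v = 0 := by
          by_contra hv
          refine h ?_
          rw [h', tsub_add_cancel_of_le]
          simpa [Nat.one_le_iff_ne_zero] using hv
        simp [hv]
      · rfl

-- What matters is the exponent `|σ| + |τ|`, one less than the number of indices of the operator
-- family. Exponents of X are allowed up to `2 * D` only to share an index type with the shifted
-- exponents of z.
variable (σ τ) in
theorem exists_boxSpan_le_span [Fintype σ] [Fintype τ] (D : ℕ) :
    ∃ s : Finset (MvPowerSeries σ (LaurentPoly τ)),
      s.card ≤ (2 * D + 1) ^ (Fintype.card σ + Fintype.card τ) ∧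
      boxSpan σ τ D ≤ Submodule.span ℚ (s : Set (MvPowerSeries σ (LaurentPoly τ))) := by
  classical
  let b : (σ → Fin (2 * D + 1)) × (τ → Fin (2 * D + 1)) → MvPowerSeries σ (LaurentPoly τ) :=
    fun p => monomial (Finsupp.equivFunOnFinite.symm fun i => (p.1 i : ℕ))
      (AddMonoidAlgebra.single (fun k => ((p.2 k : ℕ) : ℤ) - D) 1)
  refine ⟨Finset.univ.image b, Finset.card_image_le.trans ?_, Submodule.span_mono ?_⟩
  · simp [pow_add]
  · rintro _ ⟨e, m, he, hm, rfl⟩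
    simp only [Finset.coe_image, Finset.coe_univ, Set.image_univ, Set.mem_range]
    refine ⟨⟨fun i => ⟨e i, by have := he i; omega⟩, fun k => ⟨(m k + D).toNat, ?_⟩⟩, ?_⟩
    · have := abs_le.1 (hm k)
      omega
    · have h : (fun k => (((m k + D).toNat : ℕ) : ℤ) - D) = m := by
        funext k
        have := abs_le.1 (hm k)
        omega
      simp only [b, h]
      congr 1
      congr 1
      ext i
      rfl

end Box

/-! ### Fractions filtered by the power of the denominator -/

section Fractions

open MvPowerSeries

variable {σ τ : Type*}

/-- The fractions `v ^ (n + 1) * w` with `w` in the box of size `E * (n + 1)`. -/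
noncomputable def fracSpan (v : MvPowerSeries σ (LaurentPoly τ)) (E n : ℕ) :
    Submodule ℚ (MvPowerSeries σ (LaurentPoly τ)) :=
  (boxSpan σ τ (E * (n + 1))).map (LinearMap.mulLeft ℚ (v ^ (n + 1)))

theorem mem_fracSpan {v g : MvPowerSeries σ (LaurentPoly τ)} {E n : ℕ} :
    g ∈ fracSpan v E n ↔ ∃ w ∈ boxSpan σ τ (E * (n + 1)), v ^ (n + 1) * w = g := by
  simp [fracSpan]

variable {u v : MvPowerSeries σ (LaurentPoly τ)} {D E : ℕ}

theorem pow_mem_boxSpan (hu : u ∈ boxSpan σ τ D) (s : ℕ) : u ^ s ∈ boxSpan σ τ (D * s) := by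
  induction s with
  | zero => simpa using one_mem_boxSpan
  | succ s ih => rw [pow_succ, mul_add, mul_one]; exact mul_mem_boxSpan ih hu

/-- Expanding the fraction by `u ^ s` costs degree `D * s`, and `p` costs `s` more; `D + 1 ≤ E` pays
for both. -/
theorem mul_mem_fracSpan (huv : u * v = 1) (hu : u ∈ boxSpan σ τ D) (hDE : D + 1 ≤ E)
    {p g : MvPowerSeries σ (LaurentPoly τ)} {n s : ℕ} (hp : p ∈ boxSpan σ τ s)
    (hg : g ∈ fracSpan v E n) : p * g ∈ fracSpan v E (n + s) := by
  obtain ⟨w, hw, rfl⟩ := mem_fracSpan.1 hg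
  refine mem_fracSpan.2 ⟨u ^ s * p * w, ?_, ?_⟩
  · refine boxSpan_mono ?_ (mul_mem_boxSpan (mul_mem_boxSpan (pow_mem_boxSpan hu s) hp) hw)
    calc D * s + s + E * (n + 1) = (D + 1) * s + E * (n + 1) := by ring
      _ ≤ E * s + E * (n + 1) := by gcongr
      _ = E * (n + s + 1) := by ring
  · have : u ^ s * v ^ s = 1 := by rw [← mul_pow, huv, one_pow]
    calc v ^ (n + s + 1) * (u ^ s * p * w) = (u ^ s * v ^ s) * (p * (v ^ (n + 1) * w)) := by ring
      _ = _ := by rw [this, one_mul]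

theorem fracSpan_mono (huv : u * v = 1) (hu : u ∈ boxSpan σ τ D) (hDE : D + 1 ≤ E) :
    Monotone (fracSpan v E) := by
  intro m n h
  obtain ⟨s, rfl⟩ := Nat.exists_eq_add_of_le h
  intro g hg
  simpa using mul_mem_fracSpan huv hu hDE (boxSpan_mono (Nat.zero_le s) one_mem_boxSpan) hg

/-- The quotient rule raises the denominator power by one and the numerator degree by at most `D`;
the factor `p` takes the remaining 1. The scalars `K` vary because ∂/∂X is linear over the Laurent
polynomials, while the Euler operator is linear only over ℚ. -/
theorem mul_derivation_mem_fracSpan (huv : u * v = 1) (hu : u ∈ boxSpan σ τ D) (hDE : D + 1 ≤ E)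
    {K : Type*} [CommRing K] [Algebra K (MvPowerSeries σ (LaurentPoly τ))]
    (δ : Derivation K (MvPowerSeries σ (LaurentPoly τ)) (MvPowerSeries σ (LaurentPoly τ)))
    (hδ : ∀ (F : ℕ), ∀ w ∈ boxSpan σ τ F, δ w ∈ boxSpan σ τ F)
    {p g : MvPowerSeries σ (LaurentPoly τ)} {n : ℕ} (hp : p ∈ boxSpan σ τ 1)
    (hg : g ∈ fracSpan v E n) : p * δ g ∈ fracSpan v E (n + 1) := by
  obtain ⟨w, hw, rfl⟩ := mem_fracSpan.1 hg
  have hle : 1 + (D + E * (n + 1)) ≤ E * (n + 1 + 1) := by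
    calc 1 + (D + E * (n + 1)) = (D + 1) + E * (n + 1) := by ring
      _ ≤ E + E * (n + 1) := by gcongr
      _ = _ := by ring
  refine mem_fracSpan.2 ⟨p * (u * δ w - (n + 1) • (δ u * w)), boxSpan_mono hle
    (mul_mem_boxSpan hp (sub_mem (mul_mem_boxSpan hu (hδ _ _ hw))
      (nsmul_mem (mul_mem_boxSpan (hδ _ _ hu) hw) _))), ?_⟩
  have hv : δ v = -v ^ 2 * δ u := δ.leibniz_of_mul_eq_one (by rw [mul_comm, huv])
  rw [Derivation.leibniz, Derivation.leibniz_pow, hv]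
  simp only [smul_eq_mul, nsmul_eq_mul, Nat.add_sub_cancel]
  calc _ = p * v ^ (n + 1) * ((u * v) * δ w) - ((n + 1 : ℕ) : MvPowerSeries σ (LaurentPoly τ)) *
        (p * v ^ (n + 1 + 1) * δ u * w) := by ring
    _ = _ := by rw [huv]; ring

theorem pderiv_mem_fracSpan (huv : u * v = 1) (hu : u ∈ boxSpan σ τ D) (hDE : D + 1 ≤ E) (x : σ)
    {g : MvPowerSeries σ (LaurentPoly τ)} {n : ℕ} (hg : g ∈ fracSpan v E n) :
    pderiv _ x g ∈ fracSpan v E (n + 1) := by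
  simpa using mul_derivation_mem_fracSpan huv hu hDE (pderiv _ x)
    (fun _ _ => pderiv_mem_boxSpan x) (boxSpan_mono zero_le_one one_mem_boxSpan) hg

theorem iterate_pderiv_mem_fracSpan (huv : u * v = 1) (hu : u ∈ boxSpan σ τ D) (hDE : D + 1 ≤ E)
    (x : σ) {g : MvPowerSeries σ (LaurentPoly τ)} {n : ℕ} (hg : g ∈ fracSpan v E n) (c : ℕ) :
    (⇑(pderiv (LaurentPoly τ) x))^[c] g ∈ fracSpan v E (n + c) := by
  induction c with
  | zero => exact hg
  | succ c ih =>
    rw [Function.iterate_succ_apply']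
    exact pderiv_mem_fracSpan huv hu hDE x ih

theorem lowerOp_mem_fracSpan [DecidableEq τ] (huv : u * v = 1) (hu : u ∈ boxSpan σ τ D)
    (hDE : D + 1 ≤ E) (k : τ) {g : MvPowerSeries σ (LaurentPoly τ)} {n : ℕ}
    (hg : g ∈ fracSpan v E n) : lowerOp k g ∈ fracSpan v E (n + 1) := by
  rw [lowerOp, mul_sub]
  exact sub_mem (mul_derivation_mem_fracSpan huv hu hDE _
    (fun _ _ => mapDerivation_eulerDerivation_mem_boxSpan k) (C_single_mem_boxSpan k) hg)
    (mul_mem_fracSpan huv hu hDE (C_single_mem_boxSpan k) hg)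

/-- The composite of the operators `lowerOp k`, each taken `γ k` times, stays within the spaces of
fractions, and its effect on coefficients is a shift by `γ` together with a multiplication by
rising factorials. -/
theorem exists_iterated_lowerOp [Fintype τ] (huv : u * v = 1) (hu : u ∈ boxSpan σ τ D)
    (hDE : D + 1 ≤ E) {f : MvPowerSeries σ (LaurentPoly τ)} (hf : f ∈ fracSpan v E 0)
    (γ : τ → ℕ) :
    ∃ g ∈ fracSpan v E (∑ k, γ k), ∀ m : τ → ℤ, laurentCoeff σ m g =
      ((∏ k, (ascPochhammer ℤ (γ k)).eval (m k) : ℤ) : ℚ) •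
        laurentCoeff σ (m + fun k => (γ k : ℤ)) f := by
  classical
  obtain ⟨n, hn⟩ : ∃ n, n = ∑ k, γ k := ⟨_, rfl⟩
  induction n generalizing γ with
  | zero =>
    have hγ : γ = 0 := by
      funext k
      exact Finset.sum_eq_zero_iff.1 hn.symm k (Finset.mem_univ k)
    subst hγ
    refine ⟨f, by simpa using hf, fun m => ?_⟩
    have : (m + fun k => (((0 : τ → ℕ) k : ℕ) : ℤ)) = m := by ext; simp
    rw [this]
    simp
  | succ n ih =>
    obtain ⟨k, hk⟩ : ∃ k, γ k ≠ 0 := by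
      by_contra! h
      simp [h] at hn
    obtain ⟨β, rfl⟩ : ∃ β : τ → ℕ, γ = β + Pi.single k 1 := by
      refine ⟨γ - Pi.single k 1, ?_⟩
      rw [tsub_add_cancel_of_le]
      intro j
      by_cases h : j = k
      · subst h; simpa [Nat.one_le_iff_ne_zero] using hk
      · simp [h]
    have hsum : ∑ j, (β + Pi.single k 1 : τ → ℕ) j = ∑ j, β j + 1 := by
      simp [Finset.sum_add_distrib]
    obtain ⟨g, hg, hgm⟩ := ih β (by omega)
    refine ⟨lowerOp k g, ?_, fun m => ?_⟩
    · rw [hsum]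
      exact lowerOp_mem_fracSpan huv hu hDE k hg
    · rw [laurentCoeff_lowerOp, hgm, smul_smul]
      congr 1
      · rw [← Int.cast_mul]
        congr 1
        rw [← Finset.mul_prod_erase _ _ (Finset.mem_univ k), ← mul_assoc]
        refine Eq.trans ?_ (Finset.mul_prod_erase Finset.univ _ (Finset.mem_univ k))
        congr 1
        · simp [ascPochhammer_succ_left]
        · refine Finset.prod_congr rfl fun j hj => ?_
          simp [Finset.ne_of_mem_erase hj]
      · have : (m + Pi.single k 1 + fun j => (β j : ℤ)) =
            m + fun j => (((β + Pi.single k 1 : τ → ℕ) j : ℕ) : ℤ) := by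
          ext j
          simp only [Pi.add_apply, Nat.cast_add]
          by_cases h : j = k
          · subst h; simp; ring
          · simp [h]
        rw [this]

end Fractions

/-! ### Dimension count and elimination of z -/

section Counting

open MvPowerSeries

variable {σ τ : Type*} {u v : MvPowerSeries σ (LaurentPoly τ)} {D E : ℕ}

/-- Fewer fractions than operators: any family indexed by `|σ| + 1 + |τ|` natural numbers, whose
members have the fraction degree given by the sum of the indices, is linearly dependent. -/
theorem exists_linear_relation [Fintype σ] [Fintype τ] [DecidableEq σ] [DecidableEq τ]
    (hmono : Monotone (fracSpan v E))
    (e : (σ → ℕ) → ℕ → (τ → ℕ) → MvPowerSeries σ (LaurentPoly τ))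
    (he : ∀ α c γ, e α c γ ∈ fracSpan v E (∑ k, γ k + c + ∑ i, α i)) :
    ∃ N : ℕ, ∃ r : (σ → Fin (N + 1)) × Fin (N + 1) × (τ → Fin (N + 1)) → ℚ,
      ∑ p, r p • e (fun i => p.1 i) p.2.1 (fun k => p.2.2 k) = 0 ∧ ∃ p, r p ≠ 0 := by
  classical
  set d := Fintype.card σ + Fintype.card τ with hd
  -- `C` bounds the side of the box: 2E((d+1)N+1) + 1 ≤ C(N+1). With N = C^d, independence would
  -- give (N+1)^(d+1) ≤ (C(N+1))^d = N(N+1)^d, which is false.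
  set C := 2 * E * (d + 2) + 1 with hC
  refine ⟨C ^ d, Fintype.not_linearIndependent_iff.1 fun hli => ?_⟩
  set N := C ^ d with hN
  obtain ⟨s, hs, hspan⟩ := exists_boxSpan_le_span σ τ (E * ((d + 1) * N + 1))
  have hle := linearIndependent_le_span_aux' _ hli
    ((s.image (LinearMap.mulLeft ℚ (v ^ ((d + 1) * N + 1))) :
      Finset (MvPowerSeries σ (LaurentPoly τ))) : Set _) ?_
  · have h1 : (N + 1) ^ (d + 1) ≤ (C * (N + 1)) ^ d := by
      calc (N + 1) ^ (d + 1) =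
          Fintype.card ((σ → Fin (N + 1)) × Fin (N + 1) × (τ → Fin (N + 1))) := by
            simp only [Fintype.card_prod, Fintype.card_fun, Fintype.card_fin, hd]; ring
        _ ≤ _ := hle
        _ ≤ s.card := by simpa using Finset.card_image_le
        _ ≤ _ := hs
        _ ≤ (C * (N + 1)) ^ d := by
            refine Nat.pow_le_pow_left ?_ d
            rw [hC]
            nlinarith [Nat.zero_le (E * N), Nat.zero_le (E * d), Nat.zero_le N, Nat.zero_le E]
    rw [mul_pow, ← hN, pow_succ, mul_comm] at h1
    have := Nat.le_of_mul_le_mul_right h1 (by positivity)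
    omega
  · rintro _ ⟨p, rfl⟩
    have hp : ∑ k, ((p.2.2 k : Fin (N + 1)) : ℕ) + (p.2.1 : ℕ) + ∑ i, ((p.1 i : Fin (N + 1)) : ℕ) ≤
        (d + 1) * N := by
      have h1 := Finset.sum_le_card_nsmul Finset.univ (fun k => (p.2.2 k : ℕ)) N
        fun k _ => Nat.le_of_lt_succ (p.2.2 k).2
      have h2 := Finset.sum_le_card_nsmul Finset.univ (fun k => (p.1 k : ℕ)) N
        fun k _ => Nat.le_of_lt_succ (p.1 k).2
      have h3 := Nat.le_of_lt_succ p.2.1.2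
      simp only [Finset.card_univ, smul_eq_mul] at h1 h2
      calc _ ≤ Fintype.card τ * N + N + Fintype.card σ * N := by gcongr
        _ = (d + 1) * N := by rw [hd]; ring
    have h := hmono hp (he (fun i => p.1 i) p.2.1 (fun k => p.2.2 k))
    rw [Finset.coe_image, Submodule.span_image]
    exact Submodule.map_mono hspan h

/-- The constant term in `z` of a fraction is D-finite. -/
theorem isDFinite_laurentCoeff_zero [Finite σ] [Finite τ] (huv : u * v = 1)
    (hu : u ∈ boxSpan σ τ D) (hDE : D + 1 ≤ E) {f : MvPowerSeries σ (LaurentPoly τ)}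
    (hf : f ∈ fracSpan v E 0) : IsDFinite (laurentCoeff σ 0 f) := by
  classical
  have := Fintype.ofFinite σ
  have := Fintype.ofFinite τ
  intro x
  choose g hg hgm using exists_iterated_lowerOp huv hu hDE hf
  obtain ⟨N, r, hr, ⟨p₀, hp₀⟩⟩ := exists_linear_relation (fracSpan_mono huv hu hDE)
    (fun α c γ => monomial (Finsupp.equivFunOnFinite.symm α) 1 *
      (⇑(pderiv (LaurentPoly τ) x))^[c] (g γ))
    (fun α c γ => mul_mem_fracSpan huv hu hDE
      (monomial_mem_boxSpan (m := 0)
        (fun i => Finset.single_le_sum (f := α) (fun _ _ => Nat.zero_le _) (Finset.mem_univ i))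
        (fun k => by simp only [Pi.zero_apply, abs_zero]; positivity) 1)
      (iterate_pderiv_mem_fracSpan huv hu hDE x (hg γ) c))
  -- Minimality is in the product order: a `γ ≤ γ₀` other than `γ₀` has no nonzero coefficient, and
  -- any other `γ ≠ γ₀` exceeds `γ₀` in some coordinate, where its rising factorial at `-γ₀ k`
  -- contains the factor 0.
  obtain ⟨γ₀, hγ₀⟩ := (Set.toFinite {γ : τ → Fin (N + 1) | ∃ α c, r (α, c, γ) ≠ 0}).exists_minimal
    ⟨p₀.2.2, p₀.1, p₀.2.1, hp₀⟩
  obtain ⟨⟨α₀, c₀, hr₀⟩, hmin⟩ := hγ₀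
  set κ : (τ → Fin (N + 1)) → ℚ := fun γ =>
    ((∏ k, (ascPochhammer ℤ (γ k)).eval (-((γ₀ k : ℕ) : ℤ)) : ℤ) : ℚ) with hκ
  -- The rising factorial of length `γ₀ k` at `-γ₀ k` has the factors `-γ₀ k, …, -1` and stops just
  -- before 0.
  have hκ₀ : κ γ₀ ≠ 0 := by
    rw [hκ, Int.cast_ne_zero, Finset.prod_ne_zero_iff]
    intro k _ h
    obtain ⟨j, hj, hj'⟩ := (ascPochhammer_eval_eq_zero_iff _ _).1 h
    rw [neg_neg] at hj'
    have : j = (γ₀ k : ℕ) := by exact_mod_cast hj'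
    omega
  have hκ_ne : ∀ α c γ, γ ≠ γ₀ → r (α, c, γ) * κ γ = 0 := by
    intro α c γ hne
    by_cases hle : γ ≤ γ₀
    · have : r (α, c, γ) = 0 := by
        by_contra h
        exact hne (le_antisymm hle (hmin ⟨α, c, h⟩ hle))
      rw [this, zero_mul]
    · obtain ⟨k, hk⟩ := not_forall.1 hle
      have : κ γ = 0 := by
        rw [hκ, Int.cast_eq_zero]
        exact Finset.prod_eq_zero (Finset.mem_univ k)
          (ascPochhammer_eval_neg_coe_nat_of_lt (Fin.lt_def.1 (not_le.1 hk)))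
      rw [this, mul_zero]
  refine ⟨N, fun c => ∑ α : σ → Fin (N + 1), MvPolynomial.monomial
    (Finsupp.equivFunOnFinite.symm fun i => (α i : ℕ)) (r (α, c, γ₀)), fun h => hr₀ ?_, ?_⟩
  -- Distinct `α` give distinct monomials, so the coefficient of X^α₀ isolates `r (α₀, c₀, γ₀)`.
  · have h := congrArg (MvPolynomial.coeff (Finsupp.equivFunOnFinite.symm fun i => (α₀ i : ℕ)))
      (congrFun h c₀)
    simp only [MvPolynomial.coeff_sum, MvPolynomial.coeff_monomial, Pi.zero_apply,
      MvPolynomial.coeff_zero] at h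
    rw [Finset.sum_eq_single α₀] at h
    · simpa using h
    · intro α _ hne
      rw [if_neg]
      intro h
      exact hne (funext fun i => Fin.ext (congrFun (Finsupp.equivFunOnFinite.symm.injective h) i))
    · simp
  · have h := congrArg (laurentCoeff σ fun k => -((γ₀ k : ℕ) : ℤ)) hr
    simp only [map_sum, map_smul, laurentCoeff_monomial_mul, laurentCoeff_iterate_pderiv, hgm,
      map_zero] at h
    have hiter : ∀ (c : ℕ) (q : ℚ) (h : MvPowerSeries σ ℚ),
        (⇑(pderiv ℚ x))^[c] (q • h) = q • (⇑(pderiv ℚ x))^[c] h := by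
      intro c q h
      exact (Function.Semiconj.iterate_right (f := fun h : MvPowerSeries σ ℚ => q • h)
        (fun h => ((pderiv ℚ x).map_smul q h).symm) c h).symm
    simp only [hiter, mul_smul_comm, smul_smul, Fintype.sum_prod_type] at h
    rw [← smul_right_injective _ hκ₀ |>.eq_iff, smul_zero, ← h, Finset.sum_comm, Finset.smul_sum]
    refine Finset.sum_congr rfl fun c _ => ?_
    rw [← MvPolynomial.coeToMvPowerSeries.ringHom_apply, map_sum, Finset.sum_mul, Finset.smul_sum]
    refine Finset.sum_congr rfl fun α _ => ?_
    rw [Finset.sum_eq_single γ₀]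
    · have : ((fun k => -((γ₀ k : ℕ) : ℤ)) + fun k => ((γ₀ k : ℕ) : ℤ)) = 0 := by ext; simp
      rw [this, MvPolynomial.coeToMvPowerSeries.ringHom_apply, MvPolynomial.coe_monomial]
      have : (monomial (Finsupp.equivFunOnFinite.symm fun i => (α i : ℕ)) (r (α, c, γ₀)) :
          MvPowerSeries σ ℚ) = r (α, c, γ₀) •
            monomial (Finsupp.equivFunOnFinite.symm fun i => (α i : ℕ)) 1 := by
        rw [← map_smul, smul_eq_mul, mul_one]
      rw [this, smul_mul_assoc, smul_smul, mul_comm]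
    · intro γ _ hne
      have := hκ_ne α c γ hne
      rw [hκ] at this
      rw [this, zero_smul]
    · simp

end Counting

/-! ### Products of geometric series as fractions -/

section Geometric

open MvPowerSeries

/-- The series `1 / ∏ i, (1 - a i * X i)`. -/
def MvPowerSeries.geomSeries {σ R : Type*} [CommRing R] (a : σ → R) : MvPowerSeries σ R :=
  fun e => e.prod fun i n => a i ^ n

variable {σ τ : Type*}

theorem MvPowerSeries.coeff_geomSeries {R : Type*} [CommRing R] (a : σ → R) (e : σ →₀ ℕ) :
    coeff e (geomSeries a) = e.prod fun i n => a i ^ n :=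
  rfl

/-- Each factor cancels the geometric series in its own variable. Partial products over `T` are
considered so that the factors can be added one at a time. -/
theorem MvPowerSeries.coeff_prod_one_sub_mul_geomSeries [DecidableEq σ] {R : Type*} [CommRing R]
    (a : σ → R) (T : Finset σ) (e : σ →₀ ℕ) :
    coeff e ((∏ i ∈ T, (1 - C (a i) * X i)) * geomSeries a) =
      if ∀ i ∈ T, e i = 0 then e.prod fun i n => a i ^ n else 0 := by
  induction T using Finset.induction_on generalizing e with
  | empty => simp [coeff_geomSeries]
  | insert j T hj ih =>
    rw [Finset.prod_insert hj, mul_assoc, sub_mul, one_mul, map_sub, mul_assoc (C (a j)),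
      coeff_C_mul, X_def, coeff_monomial_mul, ih]
    by_cases hle : Finsupp.single j 1 ≤ e
    · obtain ⟨e, rfl⟩ := exists_add_of_le hle
      have h1 : ¬ ∀ i ∈ insert j T, (Finsupp.single j 1 + e : σ →₀ ℕ) i = 0 := by
        intro h
        simpa using h j (Finset.mem_insert_self _ _)
      have h2 : (∀ i ∈ T, (Finsupp.single j 1 + e : σ →₀ ℕ) i = 0) ↔ ∀ i ∈ T, e i = 0 := by
        refine forall₂_congr fun i hi => ?_
        have : i ≠ j := fun h => hj (h ▸ hi)
        simp [this]
      rw [if_pos hle, if_neg h1, add_tsub_cancel_left, ih, one_mul]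
      simp only [h2]
      split_ifs
      · rw [Finsupp.prod_add_index' (by simp) (fun i => pow_add (a i)),
          Finsupp.prod_single_index (by simp), pow_one, sub_self]
      · simp
    · have h0 : e j = 0 := by simpa using hle
      rw [if_neg hle, mul_zero, sub_zero]
      simp [h0]

theorem MvPowerSeries.prod_one_sub_mul_geomSeries [Fintype σ] {R : Type*} [CommRing R]
    (a : σ → R) : (∏ i, (1 - C (a i) * X i)) * geomSeries a = 1 := by
  classical
  ext e
  rw [coeff_prod_one_sub_mul_geomSeries, coeff_one]
  have : (∀ i ∈ Finset.univ, e i = 0) ↔ e = 0 := by simp [Finsupp.ext_iff]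
  simp only [this]
  split_ifs with h <;> simp [h]

/-- The generating function of the constant terms of `c * ∏ i, a i ^ e i`, for Laurent polynomials
`c` and `a i`, is D-finite. -/
theorem isDFinite_of_constantTerm [Finite σ] [Finite τ] (a : σ → LaurentPoly τ) (c : LaurentPoly τ)
    (F : MvPowerSeries σ ℚ)
    (hF : ∀ e, coeff e F = (c * e.prod fun i n => a i ^ n).coeff 0) : IsDFinite F := by
  have := Fintype.ofFinite σ
  obtain ⟨D, hD⟩ := exists_prod_mem_boxSpan Finset.univ
    (fun i => (1 - C (a i) * X i : MvPowerSeries σ (LaurentPoly τ))) (fun i _ => by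
      obtain ⟨B, hB⟩ := exists_C_mem_boxSpan (σ := σ) (a i)
      exact ⟨B + 1, sub_mem (boxSpan_mono (Nat.zero_le _) one_mem_boxSpan)
        (mul_mem_boxSpan hB (X_mem_boxSpan i))⟩)
  obtain ⟨B, hB⟩ := exists_C_mem_boxSpan (σ := σ) c
  have hf : geomSeries a * C c ∈ fracSpan (geomSeries a) (D + 1 + B) 0 :=
    mem_fracSpan.2 ⟨C c, boxSpan_mono (by omega) hB, by simp⟩
  convert isDFinite_laurentCoeff_zero (prod_one_sub_mul_geomSeries a) hD
    (Nat.le_add_right _ B) hf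
  ext e
  rw [hF, coeff_laurentCoeff, coeff_mul_C, coeff_geomSeries, mul_comm]

end Geometric

/-! ### The reflection principle for Laurent polynomials -/

section Reflection

open AddMonoidAlgebra

variable {d : ℕ}

/-- The sum of the monomials `z ^ s` over all steps `s`. -/
noncomputable def stepPoly (S : Finset (Fin d → ℤ)) : LaurentPoly (Fin d) :=
  ∑ s ∈ S, single s 1

/-- The product of `1 - z_k ^ (-2)` over the coordinates `k ∈ T`. -/
noncomputable def reflectionPoly (T : Finset (Fin d)) : LaurentPoly (Fin d) :=
  ∏ k ∈ T, (1 - single (-Pi.single k 2) 1)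

/-- The number of all walks ending at `i`, counted with the signs of the reflection principle. -/
noncomputable def signedCount (S : Finset (Fin d → ℤ)) (n : ℕ) (i : Fin d → ℤ) : ℚ :=
  (reflectionPoly Finset.univ * stepPoly S ^ n).coeff i

/-- Changing the sign of the coordinate `k`. -/
def negCoord (k : Fin d) : (Fin d → ℤ) ≃+ (Fin d → ℤ) where
  toFun i := Function.update i k (-(i k))
  invFun i := Function.update i k (-(i k))
  left_inv i := by simp
  right_inv i := by simp
  map_add' i j := by
    ext l
    by_cases h : l = k
    · subst h; simp [add_comm]
    · simp [h]

theorem negCoord_apply (k : Fin d) (i : Fin d → ℤ) :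
    negCoord k i = Function.update i k (-(i k)) :=
  rfl

theorem signedCount_succ (S : Finset (Fin d → ℤ)) (n : ℕ) (i : Fin d → ℤ) :
    signedCount S (n + 1) i = ∑ s ∈ S, signedCount S n (i - s) := by
  rw [signedCount, pow_succ, ← mul_assoc, stepPoly, Finset.mul_sum, coeff_sum,
    Finsupp.finsetSum_apply]
  refine Finset.sum_congr rfl fun s _ => ?_
  rw [coeff_mul_single_apply, mul_one, ← sub_eq_add_neg]
  rfl

theorem domCongr_stepPoly {S : Finset (Fin d → ℤ)} (k : Fin d)
    (hS : ∀ s ∈ S, negCoord k s ∈ S) :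
    domCongr ℚ ℚ (negCoord k) (stepPoly S) = stepPoly S := by
  rw [stepPoly, map_sum]
  refine Finset.sum_bij' (fun s _ => negCoord k s) (fun s _ => negCoord k s) hS hS
    (fun s _ => (negCoord k).left_inv s) (fun s _ => (negCoord k).left_inv s) fun s _ => ?_
  exact domCongr_single ..

/-- Under z_k ↦ z_k⁻¹ the k-th factor becomes 1 - z_k² = -z_k²(1 - z_k⁻²), and the other factors are
fixed. -/
theorem domCongr_reflectionPoly (k : Fin d) :
    domCongr ℚ ℚ (negCoord k) (reflectionPoly Finset.univ) =
      -(single (Pi.single k 2) 1 * reflectionPoly Finset.univ) := by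
  have hsplit : reflectionPoly Finset.univ = (1 - single (-Pi.single k 2) 1) *
      ∏ j ∈ Finset.univ.erase k, (1 - single (-Pi.single j 2) 1 : LaurentPoly (Fin d)) :=
    (Finset.mul_prod_erase Finset.univ _ (Finset.mem_univ k)).symm
  rw [hsplit, map_mul, map_prod, ← mul_assoc, ← neg_mul]
  congr 1
  · rw [map_sub, map_one, domCongr_single, mul_sub, mul_one, single_mul_single, neg_sub]
    have : negCoord k (-Pi.single k 2) = Pi.single k 2 := by
      ext l
      by_cases h : l = k
      · subst h; simp [negCoord_apply]
      · simp [negCoord_apply, h]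
    rw [this, add_neg_cancel, mul_one]
    rfl
  · refine Finset.prod_congr rfl fun j hj => ?_
    rw [map_sub, map_one, domCongr_single]
    have : negCoord k (-Pi.single j 2) = -Pi.single j 2 := by
      ext l
      by_cases h : l = k
      · subst h; simp [negCoord_apply, (Finset.ne_of_mem_erase hj).symm]
      · simp [negCoord_apply, h]
    rw [this]

/-- The inversion of z_k multiplies the whole Laurent polynomial by -z_k², so its coefficients are
antisymmetric under i_k ↦ -2 - i_k. This map fixes i_k = -1, where a coefficient is therefore its
own negative. -/
theorem signedCount_eq_zero {S : Finset (Fin d → ℤ)} (k : Fin d)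
    (hS : ∀ s ∈ S, negCoord k s ∈ S) (n : ℕ) (i : Fin d → ℤ) (hi : i k = -1) :
    signedCount S n i = 0 := by
  have h : domCongr ℚ ℚ (negCoord k) (reflectionPoly Finset.univ * stepPoly S ^ n) =
      -(single (Pi.single k 2) 1 * (reflectionPoly Finset.univ * stepPoly S ^ n)) := by
    rw [map_mul, map_pow, domCongr_stepPoly k hS, domCongr_reflectionPoly, neg_mul, mul_assoc]
  have h' := congrArg (fun x => x.coeff (negCoord k i)) h
  simp only [coeff_domCongr, coeff_neg, Finsupp.neg_apply, coeff_single_mul_apply, one_mul] at h'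
  have h1 : (negCoord k).symm (negCoord k i) = i := (negCoord k).symm_apply_apply i
  have h2 : -Pi.single k 2 + negCoord k i = i := by
    ext l
    by_cases h : l = k
    · subst h; simp [negCoord_apply, hi]
    · simp [negCoord_apply, h]
  rw [h1, h2] at h'
  rw [signedCount]
  linarith

/-- Every monomial of the expanded product other than 1 has a negative exponent. -/
theorem coeff_reflectionPoly (T : Finset (Fin d)) (i : Fin d → ℤ) (hi : ∀ k, 0 ≤ i k) :
    (reflectionPoly T).coeff i = if i = 0 then 1 else 0 := by
  induction T using Finset.induction_on generalizing i with
  | empty =>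
    rw [reflectionPoly, Finset.prod_empty, one_def, coeff_single, Finsupp.single_apply]
    simp [eq_comm]
  | insert j T hj ih =>
    rw [reflectionPoly, Finset.prod_insert hj, ← reflectionPoly, sub_mul, one_mul, coeff_sub,
      Finsupp.sub_apply, coeff_single_mul_apply, neg_neg, one_mul, ih i hi, ih _ ?_,
      if_neg (c := Pi.single j 2 + i = 0), sub_zero]
    · intro h
      have := congrFun h j
      have := hi j
      simp at *
      omega
    · intro k
      have := hi k
      by_cases h : k = j
      · subst h; simp; omega
      · simp [h, this]

theorem signedCount_zero (S : Finset (Fin d → ℤ)) (i : Fin d → ℤ) (hi : ∀ k, 0 ≤ i k) :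
    signedCount S 0 i = if i = 0 then 1 else 0 := by
  rw [signedCount, pow_zero, mul_one, coeff_reflectionPoly _ i hi]

end Reflection

/-! ### Recursion for walks in the orthant -/

section Walks

variable {d : ℕ}

theorem walkPosition_init {n : ℕ} (w : Fin (n + 1) → Fin d → ℤ) {m : ℕ} (hm : m ≤ n) :
    walkPosition w m = walkPosition (Fin.init w) m := by
  rw [walkPosition, walkPosition, Finset.sum_filter, Finset.sum_filter, Fin.sum_univ_castSucc]
  simp [hm, Fin.init]

theorem walkPosition_succ_eq {n : ℕ} (w : Fin (n + 1) → Fin d → ℤ) :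
    walkPosition w (n + 1) = walkPosition (Fin.init w) n + w (Fin.last n) := by
  rw [walkPosition, walkPosition, Finset.sum_filter, Finset.sum_filter, Fin.sum_univ_castSucc]
  simp [Fin.init]

theorem walkCount_zero (S : Finset (Fin d → ℤ)) (i : Fin d → ℤ) :
    walkCount S i 0 = if i = 0 then 1 else 0 := by
  classical
  have h : ∀ m (w : Fin 0 → Fin d → ℤ), walkPosition w m = 0 := fun m w => by
    simp [walkPosition]
  split_ifs with hi
  · rw [walkCount, Finset.card_eq_one]
    refine ⟨0, ?_⟩
    ext w
    refine iff_of_true ?_ (Finset.mem_singleton.2 (Subsingleton.elim _ _))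
    simpa [orthantWalks, h, hi] using Subsingleton.elim w _
  · rw [walkCount, Finset.card_eq_zero, Finset.filter_eq_empty_iff]
    intro w _ hw
    exact hi (hw.symm.trans (h _ w))

theorem walkCount_succ (S : Finset (Fin d → ℤ)) (i : Fin d → ℤ) (hi : ∀ k, 0 ≤ i k) (n : ℕ) :
    walkCount S i (n + 1) = ∑ s ∈ S, walkCount S (i - s) n := by
  classical
  rw [walkCount, Finset.card_eq_sum_card_fiberwise (f := fun w => w (Fin.last n)) (t := S)]
  · refine Finset.sum_congr rfl fun s hs => ?_
    rw [walkCount]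
    refine Finset.card_bij' (fun w _ => Fin.init w) (fun w _ => Fin.snoc w s) ?_ ?_ ?_ ?_
    · intro w hw
      simp only [orthantWalks, Finset.mem_filter, Fintype.mem_piFinset] at hw ⊢
      obtain ⟨⟨⟨hwS, hpos⟩, hend⟩, rfl⟩ := hw
      refine ⟨⟨fun j => hwS _, fun m hm k => ?_⟩, ?_⟩
      · rw [← walkPosition_init w hm]
        exact hpos m (by omega) k
      · rw [← hend, walkPosition_succ_eq, add_sub_cancel_right]
    · intro w hw
      simp only [orthantWalks, Finset.mem_filter, Fintype.mem_piFinset] at hw ⊢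
      obtain ⟨⟨hwS, hpos⟩, hend⟩ := hw
      have hlast : walkPosition (Fin.snoc w s : Fin (n + 1) → Fin d → ℤ) (n + 1) = i := by
        rw [walkPosition_succ_eq, Fin.init_snoc, Fin.snoc_last, hend, sub_add_cancel]
      refine ⟨⟨⟨fun j => ?_, fun m hm k => ?_⟩, hlast⟩, by simp⟩
      · refine Fin.lastCases ?_ (fun j => ?_) j
        · simpa using hs
        · simpa using hwS j
      · rcases Nat.le_succ_iff.1 hm with hm | rfl
        · rw [walkPosition_init _ hm, Fin.init_snoc]
          exact hpos m hm k
        · rw [hlast]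
          exact hi k
    · intro w hw
      obtain ⟨_, rfl⟩ := Finset.mem_filter.1 hw
      exact Fin.snoc_init_self w
    · intro w _
      exact Fin.init_snoc ..
  · intro w hw
    exact Fintype.mem_piFinset.1 (Finset.mem_filter.1 (Finset.mem_filter.1 hw).1).1 _

/-- The reflection principle for walks in the orthant. -/
theorem walkCount_eq_signedCount {S : Finset (Fin d → ℤ)} (hS : IsHighlySymmetric S) (n : ℕ)
    (i : Fin d → ℤ) (hi : ∀ k, 0 ≤ i k) : (walkCount S i n : ℚ) = signedCount S n i := by
  induction n generalizing i with
  | zero => rw [walkCount_zero, signedCount_zero S i hi]; push_cast; rfl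
  | succ n ih =>
    rw [walkCount_succ S i hi, signedCount_succ, Nat.cast_sum]
    refine Finset.sum_congr rfl fun s hs => ?_
    by_cases h : ∀ k, 0 ≤ (i - s) k
    · exact ih _ h
    · obtain ⟨k, hk⟩ := not_forall.1 h
      -- A step lowers or raises a coordinate by at most 1, so a predecessor outside the orthant has
      -- a coordinate exactly -1, where the signed count vanishes too.
      rw [walkCount_eq_zero S _ n ⟨k, not_le.1 hk⟩, Nat.cast_zero,
        signedCount_eq_zero k (fun s hs => hS.symmetric s hs k)]
      rw [Pi.sub_apply] at hk ⊢
      have := hi k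
      rcases hS.unit_steps s hs k with h | h | h <;> omega

end Walks

/-! ### Summing coefficients over the orthant -/

section Summation

open AddMonoidAlgebra

variable {d : ℕ}

/-- The linear functional on Laurent polynomials with value `χ m` on `z ^ m`. -/
noncomputable def pairing (χ : (Fin d → ℤ) → ℚ) (x : LaurentPoly (Fin d)) : ℚ :=
  x.coeff.sum fun m r => r * χ m

theorem pairing_add (χ : (Fin d → ℤ) → ℚ) (x y : LaurentPoly (Fin d)) :
    pairing χ (x + y) = pairing χ x + pairing χ y := by
  rw [pairing, coeff_add, Finsupp.sum_add_index'] <;> intros <;> simp [pairing, add_mul]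

/-- Moves a factor of the Laurent polynomial onto the functional, so that two functionals can be
compared pointwise. -/
theorem pairing_one_add_single_mul (χ : (Fin d → ℤ) → ℚ) (a : Fin d → ℤ) (r : ℚ)
    (x : LaurentPoly (Fin d)) :
    pairing χ ((1 + single a r) * x) = pairing (fun m => χ m + r * χ (a + m)) x := by
  induction x using AddMonoidAlgebra.induction_linear with
  | zero => simp [pairing]
  | add x y hx hy => rw [mul_add, pairing_add, pairing_add, hx, hy]
  | single m s =>
    rw [add_mul, one_mul, pairing_add, single_mul_single]
    simp only [pairing, coeff_single]
    rw [Finsupp.sum_single_index (by simp), Finsupp.sum_single_index (by simp),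
      Finsupp.sum_single_index (by simp)]
    ring

/-- The product of `1 + z_k⁻¹` over the coordinates `k ∈ T`. -/
noncomputable def telescopedPoly (T : Finset (Fin d)) : LaurentPoly (Fin d) :=
  ∏ k ∈ T, (1 + single (-Pi.single k 1) 1)

/-- The sum of the coefficients of `∏ k ∈ T, (1 - z_k⁻²) * x` over the exponents that are
nonnegative on `T` and zero elsewhere telescopes. -/
theorem pairing_reflectionPoly_mul (T : Finset (Fin d)) (x : LaurentPoly (Fin d)) :
    pairing (fun m => if (∀ k ∈ T, 0 ≤ m k) ∧ ∀ k ∉ T, m k = 0 then 1 else 0)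
      (reflectionPoly T * x) =
    pairing (fun m => if m = 0 then 1 else 0) (telescopedPoly T * x) := by
  induction T using Finset.induction_on generalizing x with
  | empty => simp [reflectionPoly, telescopedPoly, funext_iff]
  | insert j T hj ih =>
    rw [reflectionPoly, telescopedPoly, Finset.prod_insert hj, Finset.prod_insert hj,
      ← reflectionPoly, ← telescopedPoly, mul_assoc, mul_comm (1 + _) (telescopedPoly T), mul_assoc,
      ← ih, mul_left_comm (reflectionPoly T) (1 + _), sub_eq_add_neg,
      ← single_neg, pairing_one_add_single_mul, pairing_one_add_single_mul]
    congr 1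
    funext m
    have hsplit : ∀ m : Fin d → ℤ, ((∀ k ∈ insert j T, 0 ≤ m k) ∧ ∀ k ∉ insert j T, m k = 0) ↔
        0 ≤ m j ∧ (∀ k ∈ T, 0 ≤ m k) ∧ ∀ k ∉ T, k ≠ j → m k = 0 := by
      intro m
      simp only [Finset.mem_insert, forall_eq_or_imp, not_or, and_assoc]
      exact and_congr_right fun _ => and_congr_right fun _ =>
        forall_congr' fun k => by tauto
    have hsplit' : ∀ m : Fin d → ℤ, ((∀ k ∈ T, 0 ≤ m k) ∧ ∀ k ∉ T, m k = 0) ↔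
        m j = 0 ∧ (∀ k ∈ T, 0 ≤ m k) ∧ ∀ k ∉ T, k ≠ j → m k = 0 := by
      intro m
      constructor
      · rintro ⟨h1, h2⟩
        exact ⟨h2 j hj, h1, fun k hk _ => h2 k hk⟩
      · rintro ⟨h0, h1, h2⟩
        refine ⟨h1, fun k hk => ?_⟩
        by_cases h : k = j
        · rw [h, h0]
        · exact h2 k hk h
    have hshift : ∀ c : ℤ, ((∀ k ∈ T, 0 ≤ (-Pi.single j c + m : Fin d → ℤ) k) ∧
        ∀ k ∉ T, k ≠ j → (-Pi.single j c + m : Fin d → ℤ) k = 0) ↔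
        (∀ k ∈ T, 0 ≤ m k) ∧ ∀ k ∉ T, k ≠ j → m k = 0 := by
      intro c
      refine and_congr (forall₂_congr fun k hk => ?_) (forall₃_congr fun k _ hk => ?_)
      · have : k ≠ j := fun h => hj (h ▸ hk)
        simp [this]
      · simp [hk]
    simp only [hsplit, hsplit', hshift]
    by_cases hm : (∀ k ∈ T, 0 ≤ m k) ∧ ∀ k ∉ T, k ≠ j → m k = 0
    -- In the coordinate `j` this is [0 ≤ m] - [2 ≤ m] = [m = 0] + [m = 1], with brackets for
    -- indicators.
    · simp only [and_iff_left hm, Pi.add_apply, Pi.neg_apply, Pi.single_eq_same]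
      split_ifs <;> first | omega | norm_num
    · simp [hm]

theorem pairing_ite_zero (x : LaurentPoly (Fin d)) :
    pairing (fun m => if m = 0 then 1 else 0) x = x.coeff 0 := by
  rw [pairing, Finsupp.sum]
  simp [eq_comm]

theorem finsum_coeff_eq_pairing (x : LaurentPoly (Fin d)) :
    ∑ᶠ a : Fin d →₀ ℕ, x.coeff (fun k => (a k : ℤ)) =
      pairing (fun m => if ∀ k, 0 ≤ m k then 1 else 0) x := by
  classical
  have hinj : Function.Injective (fun (a : Fin d →₀ ℕ) (k : Fin d) => (a k : ℤ)) := by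
    intro a b h
    ext k
    exact Int.ofNat_inj.1 (congrFun h k)
  rw [← finsum_mem_range (f := fun m => x.coeff m) hinj, finsum_mem_def, pairing, Finsupp.sum]
  have hrange : ∀ m : Fin d → ℤ,
      (m ∈ Set.range fun (a : Fin d →₀ ℕ) (k : Fin d) => (a k : ℤ)) ↔ ∀ k, 0 ≤ m k := by
    intro m
    constructor
    · rintro ⟨a, rfl⟩ k
      positivity
    · intro h
      exact ⟨Finsupp.equivFunOnFinite.symm fun k => (m k).toNat, funext fun k => by simp [h k]⟩
  rw [finsum_eq_sum_of_support_subset (s := x.coeff.support)]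
  · refine Finset.sum_congr rfl fun m _ => ?_
    rw [Set.indicator_apply]
    simp only [hrange]
    split_ifs <;> simp
  · intro m hm
    rw [Function.mem_support, Set.indicator_apply] at hm
    rw [Finset.mem_coe, Finsupp.mem_support_iff]
    intro h
    simp [h] at hm

end Summation

/-! ### D-finiteness of the two generating functions -/

open AddMonoidAlgebra in
theorem isDFinite_walkGF {d : ℕ} {S : Finset (Fin d → ℤ)} (hS : IsHighlySymmetric S) :
    IsDFinite (walkGF S) := by
  refine isDFinite_of_constantTerm (τ := Fin d)
    -- Pairing the output variable z_k with the Laurent monomial z_k⁻¹ turns the extraction of z^i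
    -- into that of a constant term; t is paired with the step polynomial.
    (fun i => i.elim (stepPoly S) fun k => single (-Pi.single k 1) 1)
    (reflectionPoly Finset.univ) _ fun e => ?_
  have he : ∑ k, e (some k) • (-Pi.single k 1 : Fin d → ℤ) = -fun k => (e (some k) : ℤ) := by
    ext l
    simp [Finset.sum_apply, Pi.single_apply]
  rw [MvPowerSeries.coeff_apply, walkGF, walkCount_eq_signedCount hS _ _ fun k => by positivity,
    Finsupp.prod_fintype _ _ (by simp), Fintype.prod_option]
  simp only [Option.elim, single_pow, prod_single, one_pow, Finset.prod_const_one, he]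
  rw [← mul_assoc, coeff_mul_single_apply, mul_one, neg_neg, zero_add]
  rfl

/-- Setting z = 1 need not preserve D-finiteness for formal reasons, so the constant-term argument
is applied afresh, with t as the only output variable and the telescoped prefactor. -/
theorem isDFinite_specializeOne_walkGF {d : ℕ} {S : Finset (Fin d → ℤ)}
    (hS : IsHighlySymmetric S) : IsDFinite (specializeOne (walkGF S)) := by
  refine isDFinite_of_constantTerm (fun _ : Unit => stepPoly S) (telescopedPoly Finset.univ) _
    fun e => ?_
  have he : e = Finsupp.single () (e ()) := Finsupp.unique_single e
  have h := pairing_reflectionPoly_mul Finset.univ (stepPoly S ^ e ())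
  simp only [Finset.mem_univ, true_implies, not_true_eq_false, false_implies, implies_true,
    and_true] at h
  rw [pairing_ite_zero, ← finsum_coeff_eq_pairing] at h
  rw [Finsupp.prod_fintype _ _ (by simp), Fintype.prod_unique]
  refine Eq.trans ?_ h
  calc MvPowerSeries.coeff e (specializeOne (walkGF S))
      = PowerSeries.coeff (e ()) (specializeOne (walkGF S)) := by rw [PowerSeries.coeff, ← he]
    _ = _ := by
      rw [specializeOne, PowerSeries.coeff_mk]
      refine finsum_congr fun a => ?_
      rw [coeff_walkGF, walkCount_eq_signedCount hS _ _ fun k => by positivity]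
      rfl

theorem corollary2p4 {d : ℕ} (S : Finset (Fin d → ℤ)) (hS : IsHighlySymmetric S) :
    IsDFinite (walkGF S) ∧ IsDFinite (specializeOne (walkGF S)) :=
  ⟨isDFinite_walkGF hS, isDFinite_specializeOne_walkGF hS⟩
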